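/- All graphs are finite and simple. For a connected graph $G$, a set $S$ of vertices is a resolving set if for all vertices $x\neq y$ there is $s\in S$ with $d_G(x,s)\neq d_G(y,s)$, and $\dim(G)$ is the minimum cardinality of a resolving set. The corona product $G\odot H$ is obtained from one copy of $G$ and one copy $H_v$ of $H$ for each vertex $v$ of $G$ by joining $v$ to every vertex of $H_v$; put $G\odot^1 H=G\odot H$ and $G\odot^k H=(G\odot^{k-1}H)\odot H$ for $k\ge 2$. A wheel graph is a graph $W_{1,n}=K_1\odot C_n$ with $n\ge 3$ (a cycle $C_n$ plus one vertex adjacent to all its vertices), and a fan graph is a graph $F_{1,n}=K_1+P_n$ with $n\geq 1$ (a path $P_n$ on $n$ vertices plus one vertex adjacent to all its vertices). **Corollary.** Let $G$ be a connected graph of order $n_1\ge 2$ and let $H$ be a wheel graph or a fan graph of order $n_2\ge 8$. Then for every integer $k\ge 1$, $$\dim(G\odot^k H)=n_1(n_2+1)^{k-1}\left\lfloor\frac{2n_2}{5}\right\rfloor .$$ -/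

import Mathlib

universe u v

namespace CoronaDim

/-- The metric representation of `x` with respect to `S`: the vector of distances from `x` to
the vertices of `S`. -/
noncomputable def metricRep {V : Type u} (G : SimpleGraph V) (S : Finset V) (x : V) : S → ℕ :=
  fun s => G.dist x s

/-- `S` is a resolving set for (the connected graph) `G`: distinct vertices have distinct metric
representations with respect to `S`. -/
def IsResolving {V : Type u} (G : SimpleGraph V) (S : Finset V) : Prop :=
  ∀ x y : V, x ≠ y → metricRep G S x ≠ metricRep G S y

/-- The metric dimension of a finite connected graph: the minimum cardinality of a resolving set.
The set of cardinalities is non-empty for every finite connected graph, see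
`isResolving_univ`. -/
noncomputable def metricDim {V : Type u} (G : SimpleGraph V) : ℕ :=
  sInf {m : ℕ | ∃ S : Finset V, IsResolving G S ∧ S.card = m}

theorem isResolving_univ {V : Type u} [Fintype V] (G : SimpleGraph V) (hG : G.Connected) :
    IsResolving G Finset.univ := by
  intro x y hxy h
  have h1 : G.dist x y = G.dist y y := congrFun h ⟨y, Finset.mem_univ y⟩
  rw [SimpleGraph.dist_self] at h1
  exact hxy (hG.dist_eq_zero_iff.1 h1)

/-- Adjacency in the corona product: `inl a` is the vertex `a` of `G`, and `inr (a, x)` is the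
vertex `x` of the copy of `H` attached to `a`. -/
def coronaAdj {V : Type u} {W : Type v} (G : SimpleGraph V) (H : SimpleGraph W) :
    V ⊕ V × W → V ⊕ V × W → Prop
  | .inl a, .inl b => G.Adj a b
  | .inl a, .inr p => a = p.1
  | .inr p, .inl b => p.1 = b
  | .inr p, .inr q => p.1 = q.1 ∧ H.Adj p.2 q.2

/-- The corona product `G ⊙ H`: one copy of `G`, one copy of `H` for each vertex `a` of `G`, and
every vertex of the copy belonging to `a` joined to `a`. -/
def corona {V : Type u} {W : Type v} (G : SimpleGraph V) (H : SimpleGraph W) :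
    SimpleGraph (V ⊕ V × W) where
  Adj := coronaAdj G H
  symm := ⟨by
    rintro (a | p) (b | q) h
    · exact SimpleGraph.Adj.symm h
    · exact Eq.symm h
    · exact Eq.symm h
    · exact ⟨h.1.symm, SimpleGraph.Adj.symm h.2⟩⟩
  loopless := ⟨by
    rintro (a | p) h
    · exact G.irrefl h
    · exact H.irrefl h.2⟩

/-- The vertex type of the iterated corona product (`ULift` only adjusts the universe). -/
def CoronaPowVert (V : Type u) (W : Type v) : ℕ → Type (max u v)
  | 0 => ULift.{v} V
  | k + 1 => CoronaPowVert V W k ⊕ CoronaPowVert V W k × W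

/-- The iterated corona product `G ⊙^k H`: it is (a copy of) `G` for `k = 0`, and
`G ⊙^(k+1) H = (G ⊙^k H) ⊙ H`. -/
def coronaPow {V : Type u} {W : Type v} (G : SimpleGraph V) (H : SimpleGraph W) :
    (k : ℕ) → SimpleGraph (CoronaPowVert V W k)
  | 0 => G.comap ULift.down
  | k + 1 => corona (coronaPow G H k) H

/-- The join `G + H` of two graphs: their disjoint union together with all edges between them. -/
def join {V : Type u} {W : Type v} (G : SimpleGraph V) (H : SimpleGraph W) :
    SimpleGraph (V ⊕ W) :=
  SimpleGraph.sum G H ⊔ completeBipartiteGraph V W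

/-- The wheel graph `W_{1,n} = K_1 ⊙ C_n`, of order `n + 1`. -/
def wheelGraph (n : ℕ) : SimpleGraph (Fin 1 ⊕ Fin 1 × Fin n) :=
  corona (⊤ : SimpleGraph (Fin 1)) (SimpleGraph.cycleGraph n)

/-- The (usual) fan graph `F_{1,n} = N_1 + P_n`, of order `n + 1`. -/
def fanGraph (n : ℕ) : SimpleGraph (Fin 1 ⊕ Fin n) :=
  join (⊥ : SimpleGraph (Fin 1)) (SimpleGraph.pathGraph n)

/-- `H` is a wheel graph (up to isomorphism). -/
def IsWheel {W : Type v} (H : SimpleGraph W) : Prop :=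
  ∃ n : ℕ, 3 ≤ n ∧ Nonempty (H ≃g wheelGraph n)

/-- `H` is a fan graph (up to isomorphism). -/
def IsFan {W : Type v} (H : SimpleGraph W) : Prop :=
  ∃ n : ℕ, 1 ≤ n ∧ Nonempty (H ≃g fanGraph n)

end CoronaDim

/-!
The metric dimension of an iterated corona product reduces to an extremal problem inside `H`.

In `G ⊙ H` every path from the copy of `H` at `a` to the outside runs through `a`. Hence a vertex
outside that copy has the same distance to all its vertices, while two vertices of the copy are at
their distance in `H`, truncated at `2` (`corona_dist_inr`, `corona_dist_ne_iff`). A resolving set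
of `G ⊙ H` must therefore meet each copy in a set that resolves `H` by truncated distances
(`AdjResolving`). Conversely, if `G` has at least two vertices, such a set in every copy resolves
`G ⊙ H`. So `dim (G ⊙ H)` is the order of `G` times the least size of such a set
(`metricDim_corona`), and this is applied to the last step of the iteration.

For a wheel or fan `H`, the cone over a cycle or path on `n = n₂ - 1` vertices, the apex does not
help to resolve the rim. In a graph of maximum degree `2` on `n` vertices, let `m` be the size of a
set `T` resolving by truncated distances. The vertices outside `T` have distinct traces on `T`: at
most one is empty, at most `m` are singletons, and the trace sizes add up to at most `2 m`. This
gives `2 n ≤ 5 m + 2` (`AdjResolving.two_mul_card_le`), that is, `m ≥ ⌊2 (n + 1) / 5⌋`. An almost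
periodic choice of two rim vertices out of every five attains the bound
(`IsCone.exists_adjResolving`); as `n ≥ 7`, no rim vertex is adjacent to all chosen ones, so the
apex is told apart as well.
-/

namespace CoronaDim

open Finset

/-! ### Adjacency resolving sets -/

/-- `S` tells any two vertices `x ≠ y` of `H` apart by the distances truncated at `2`: some
`s ∈ S` is one of the two vertices, or is adjacent to exactly one of them. -/
def AdjResolving {W : Type*} (H : SimpleGraph W) (S : Finset W) : Prop :=
  ∀ x y : W, x ≠ y → ∃ s ∈ S, x = s ∨ y = s ∨ ¬(H.Adj x s ↔ H.Adj y s)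

theorem AdjResolving.nonempty {W : Type*} [Nontrivial W] {H : SimpleGraph W} {S : Finset W}
    (hS : AdjResolving H S) : S.Nonempty := by
  obtain ⟨x, y, hxy⟩ := exists_pair_ne W
  obtain ⟨s, hs, -⟩ := hS x y hxy
  exact ⟨s, hs⟩

/-! ### Distances in a corona product -/

section Corona

variable {V W : Type*} {G : SimpleGraph V} {H : SimpleGraph W}

theorem corona_adj_inl_inr (a : V) (x : W) : (corona G H).Adj (.inl a) (.inr (a, x)) :=
  rfl

theorem corona_connected (hG : G.Connected) : (corona G H).Connected := by
  have hinl : ∀ a b : V, (corona G H).Reachable (.inl a) (.inl b) := fun a b =>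
    (hG.preconnected a b).map (⟨Sum.inl, fun h => h⟩ : G →g corona G H)
  have hbase : ∀ p : V ⊕ V × W, ∃ a : V, (corona G H).Reachable p (.inl a) := by
    rintro (a | ⟨a, x⟩)
    · exact ⟨a, .rfl⟩
    · exact ⟨a, (corona_adj_inl_inr a x).symm.reachable⟩
  have := hG.nonempty
  refine ⟨fun p q => ?_⟩
  obtain ⟨a, ha⟩ := hbase p
  obtain ⟨b, hb⟩ := hbase q
  exact (ha.trans (hinl a b)).trans hb.symm

/-- A walk leaving the copy of `H` at `a` passes through `a`. -/
theorem dist_inl_add_one_le_length {a : V} {t : V ⊕ V × W} (ht : ∀ z, t ≠ .inr (a, z))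
    {p : V ⊕ V × W} (w : (corona G H).Walk p t) (x : W) (hp : p = .inr (a, x)) :
    (corona G H).dist (.inl a) t + 1 ≤ w.length := by
  induction w generalizing x with
  | nil => exact absurd hp (ht x)
  | @cons p q t h w ih =>
    subst hp
    rw [SimpleGraph.Walk.length_cons]
    rcases q with b | ⟨b, y⟩
    · obtain rfl : a = b := h
      exact Nat.succ_le_succ (SimpleGraph.dist_le w)
    · obtain ⟨rfl, -⟩ : a = b ∧ H.Adj x y := h
      exact (ih ht y rfl).trans (Nat.le_succ _)

theorem corona_dist_inr (hG : G.Connected) {a : V} {t : V ⊕ V × W} (ht : ∀ z, t ≠ .inr (a, z))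
    (x : W) :
    (corona G H).dist (.inr (a, x)) t = (corona G H).dist (.inl a) t + 1 := by
  have hc := corona_connected (H := H) hG
  apply le_antisymm
  · have h1 := hc.dist_triangle (u := .inr (a, x)) (v := .inl a) (w := t)
    rw [SimpleGraph.dist_eq_one_iff_adj.2 (corona_adj_inl_inr a x).symm] at h1
    omega
  · obtain ⟨w, hw⟩ := hc.exists_walk_length_eq_dist (.inr (a, x)) t
    rw [← hw]
    exact dist_inl_add_one_le_length ht w x rfl

theorem corona_dist_inr_inr_le (hG : G.Connected) (a : V) (x y : W) :
    (corona G H).dist (.inr (a, x)) (.inr (a, y)) ≤ 2 := by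
  have h1 := (corona_connected (H := H) hG).dist_triangle
    (u := .inr (a, x)) (v := .inl a) (w := .inr (a, y))
  rwa [SimpleGraph.dist_eq_one_iff_adj.2 (corona_adj_inl_inr a x).symm,
    SimpleGraph.dist_eq_one_iff_adj.2 (corona_adj_inl_inr a y)] at h1

theorem corona_dist_eq_zero (hG : G.Connected) (a : V) (x s : W) :
    (corona G H).dist (.inr (a, x)) (.inr (a, s)) = 0 ↔ x = s := by
  rw [(corona_connected (H := H) hG).dist_eq_zero_iff]
  simp

theorem corona_dist_eq_one (a : V) (x s : W) :
    (corona G H).dist (.inr (a, x)) (.inr (a, s)) = 1 ↔ H.Adj x s := by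
  rw [SimpleGraph.dist_eq_one_iff_adj]
  exact ⟨fun h => h.2, fun h => ⟨rfl, h⟩⟩

/-- Inside one copy of `H` the distance is that of `H` truncated at `2`. -/
theorem corona_dist_ne_iff (hG : G.Connected) (a : V) {x y : W} (hxy : x ≠ y) (s : W) :
    (corona G H).dist (.inr (a, x)) (.inr (a, s)) ≠ (corona G H).dist (.inr (a, y)) (.inr (a, s)) ↔
      x = s ∨ y = s ∨ ¬(H.Adj x s ↔ H.Adj y s) := by
  have hx := corona_dist_inr_inr_le (H := H) hG a x s
  have hy := corona_dist_inr_inr_le (H := H) hG a y s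
  have hne : ¬(x = s ∧ y = s) := fun h => hxy (h.1.trans h.2.symm)
  rw [← corona_dist_eq_zero (H := H) hG a x s, ← corona_dist_eq_zero (H := H) hG a y s] at *
  rw [← corona_dist_eq_one (G := G) (H := H) a x s, ← corona_dist_eq_one (G := G) (H := H) a y s]
  omega

/-! ### The metric dimension of a corona product -/

/-- A vertex outside the copy of `H` at `a` has the same distance to all vertices of that copy, so
these can only be told apart from within. -/
theorem IsResolving.adjResolving (hG : G.Connected) {S : Finset (V ⊕ V × W)}
    (hS : IsResolving (corona G H) S) (a : V) {T : Finset W}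
    (hT : ∀ x, x ∈ T ↔ Sum.inr (a, x) ∈ S) : AdjResolving H T := by
  intro x y hxy
  obtain ⟨⟨s, hs⟩, hne⟩ := Function.ne_iff.1
    (hS (.inr (a, x)) (.inr (a, y)) (by simpa using hxy))
  change (corona G H).dist _ s ≠ (corona G H).dist _ s at hne
  by_cases h : ∃ z, s = .inr (a, z)
  · obtain ⟨z, rfl⟩ := h
    exact ⟨z, (hT z).2 hs, (corona_dist_ne_iff hG a hxy z).1 hne⟩
  · push Not at h
    rw [corona_dist_inr hG h, corona_dist_inr hG h] at hne
    exact absurd rfl hne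

theorem isResolving_of_adjResolving [Nontrivial V] [Nontrivial W]
    (hG : G.Connected) {T : Finset W} (hT : AdjResolving H T) {S : Finset (V ⊕ V × W)}
    (hS : ∀ a, ∀ x ∈ T, Sum.inr (a, x) ∈ S) : IsResolving (corona G H) S := by
  obtain ⟨t, ht⟩ := hT.nonempty
  have hc := corona_connected (H := H) hG
  have key : ∀ p q : V ⊕ V × W, (∃ a, ∃ s ∈ T, (corona G H).dist p (.inr (a, s)) ≠
      (corona G H).dist q (.inr (a, s))) →
      metricRep (corona G H) S p ≠ metricRep (corona G H) S q := by
    rintro p q ⟨a, s, hs, hne⟩ h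
    exact hne (congrFun h ⟨_, hS a s hs⟩)
  have hone : ∀ a : V, (corona G H).dist (.inl a) (.inr (a, t)) = 1 := fun a =>
    SimpleGraph.dist_eq_one_iff_adj.2 (corona_adj_inl_inr a t)
  have hpos : ∀ a b : V, ∀ x, 0 < (corona G H).dist (.inl a) (.inr (b, x)) := fun a b x =>
    hc.pos_dist_of_ne (by simp)
  have hposG : ∀ a b : V, a ≠ b → 0 < (corona G H).dist (.inl a) (.inl b) := fun a b hab =>
    hc.pos_dist_of_ne (by simpa using hab)
  have hcross : ∀ a b : V, a ≠ b → ∀ x s : W, (corona G H).dist (.inr (a, x)) (.inr (b, s)) =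
      (corona G H).dist (.inl a) (.inr (b, s)) + 1 := fun a b hab x s =>
    corona_dist_inr hG (fun z hz => hab (congrArg Prod.fst (Sum.inr.inj hz)).symm) x
  have hup : ∀ a b : V, a ≠ b → ∀ s : W, (corona G H).dist (.inl a) (.inr (b, s)) =
      (corona G H).dist (.inl b) (.inl a) + 1 := fun a b hab s => by
    rw [SimpleGraph.dist_comm]
    exact corona_dist_inr hG (by simp) s
  have hmixed : ∀ (a b : V) (y : W), ∃ c, ∃ s ∈ T, (corona G H).dist (.inl a) (.inr (c, s)) ≠
      (corona G H).dist (.inr (b, y)) (.inr (c, s)) := by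
    intro a b y
    by_cases hab : a = b
    · subst hab
      -- The copy at `a` need not separate `a` from `y`, for `y` may be adjacent to all of `T`.
      obtain ⟨c, hc⟩ := exists_ne a
      refine ⟨c, t, ht, ?_⟩
      rw [hcross a c hc.symm]
      omega
    · refine ⟨a, t, ht, ?_⟩
      rw [hone, hcross b a (Ne.symm hab)]
      have := hpos b a t
      omega
  rintro (a | ⟨a, x⟩) (b | ⟨b, y⟩) hne
  · have hab : a ≠ b := fun h => hne (h ▸ rfl)
    refine key _ _ ⟨a, t, ht, ?_⟩
    rw [hone, hup b a hab.symm]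
    have := hposG a b hab
    omega
  · exact key _ _ (hmixed a b y)
  · exact (key _ _ (hmixed b a x)).symm
  · by_cases hab : a = b
    · subst hab
      have hxy : x ≠ y := fun h => hne (h ▸ rfl)
      obtain ⟨s, hs, h⟩ := hT x y hxy
      exact key _ _ ⟨a, s, hs, (corona_dist_ne_iff hG a hxy s).2 h⟩
    · refine key _ _ ⟨a, t, ht, ?_⟩
      rw [hcross b a (Ne.symm hab), hup b a (Ne.symm hab)]
      have := hposG a b hab
      have := corona_dist_inr_inr_le (H := H) hG a x t
      omega

/-- `dim (G ⊙ H)` is the order of `G` times the adjacency dimension of `H`. -/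
theorem metricDim_corona [Fintype V] [Nontrivial V] [Nontrivial W] (hG : G.Connected) {m : ℕ}
    (hup : ∃ T : Finset W, AdjResolving H T ∧ T.card ≤ m)
    (hlow : ∀ T : Finset W, AdjResolving H T → m ≤ T.card) :
    metricDim (corona G H) = Fintype.card V * m := by
  classical
  obtain ⟨T, hT, hTm⟩ := hup
  obtain rfl : T.card = m := le_antisymm hTm (hlow T hT)
  apply IsLeast.csInf_eq
  constructor
  · refine ⟨((univ : Finset V) ×ˢ T).map .inr, isResolving_of_adjResolving hG hT ?_, ?_⟩
    · intro a x hx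
      simpa using hx
    · rw [card_map, card_product, card_univ]
  · rintro _ ⟨S, hS, rfl⟩
    have hfib : ∀ a : V, T.card ≤ (S.toRight.filter fun p => p.1 = a).card := by
      intro a
      rw [← card_image_of_injOn (f := Prod.snd)]
      · refine hlow _ (hS.adjResolving hG a fun x => ?_)
        simp
      · rintro ⟨b, x⟩ hp ⟨c, y⟩ hq h
        simp only [coe_filter, Set.mem_ofPred_eq] at hp hq h
        rw [hp.2, hq.2, h]
    calc Fintype.card V * T.card = ∑ _a : V, T.card := by simp
      _ ≤ ∑ a : V, (S.toRight.filter fun p => p.1 = a).card := sum_le_sum fun a _ => hfib a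
      _ = S.toRight.card := (card_eq_sum_card_fiberwise fun _ _ => mem_univ _).symm
      _ ≤ S.card := by
        have := card_toLeft_add_card_toRight (u := S)
        omega

end Corona

/-! ### Iterated corona products -/

section CoronaPow

theorem finite_coronaPowVert {V : Type u} {W : Type v} [Finite V] [Finite W] (k : ℕ) :
    Finite (CoronaPowVert V W k) := by
  induction k with
  | zero => exact inferInstanceAs (Finite (ULift V))
  | succ k ih =>
    exact inferInstanceAs (Finite (CoronaPowVert V W k ⊕ CoronaPowVert V W k × W))

theorem card_coronaPowVert {V : Type u} {W : Type v} [Finite V] [Finite W] (k : ℕ) :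
    Nat.card (CoronaPowVert V W k) = Nat.card V * (Nat.card W + 1) ^ k := by
  induction k with
  | zero =>
    change Nat.card (ULift V) = _
    rw [Nat.card_congr Equiv.ulift, pow_zero, mul_one]
  | succ k ih =>
    have := finite_coronaPowVert (V := V) (W := W) k
    change Nat.card (CoronaPowVert V W k ⊕ CoronaPowVert V W k × W) = _
    rw [Nat.card_sum, Nat.card_prod, ih]
    ring

theorem coronaPow_connected {V : Type u} {W : Type v} {G : SimpleGraph V} (H : SimpleGraph W)
    (hG : G.Connected) (k : ℕ) : (coronaPow G H k).Connected := by
  induction k with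
  | zero =>
    exact (SimpleGraph.Iso.connected_iff
      (⟨Equiv.ulift, Iff.rfl⟩ : G.comap ULift.down ≃g G)).2 hG
  | succ k ih => exact corona_connected ih

end CoronaPow

/-! ### The lower bound: traces on a resolving set -/

/-- Count the vertices outside `T` by the size of their trace on `T`. At most one trace is empty,
at most `|T|` traces are singletons, and there are at most `2 |T|` edges leaving `T`. -/
theorem AdjResolving.two_mul_card_le {U : Type*} [Fintype U] [DecidableEq U] {K : SimpleGraph U}
    [DecidableRel K.Adj] (hdeg : ∀ x, (univ.filter fun y => K.Adj y x).card ≤ 2) {T : Finset U}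
    (hT : AdjResolving K T) : 2 * Fintype.card U ≤ 5 * T.card + 2 := by
  let tr : U → Finset U := fun x => T.filter fun t => K.Adj x t
  have hinj : Set.InjOn tr (Tᶜ : Finset U) := by
    intro x hx y hy hxy
    by_contra hne
    rw [mem_coe, mem_compl] at hx hy
    obtain ⟨s, hs, rfl | rfl | h⟩ := hT x y hne
    · exact hx hs
    · exact hy hs
    · have := congrArg (s ∈ ·) hxy
      simp only [tr, mem_filter, hs, true_and, eq_iff_iff] at this
      exact h this
  have hlevel : ∀ i, (Tᶜ.filter fun x => (tr x).card = i).card ≤ T.card.choose i := by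
    intro i
    rw [← card_powersetCard i T]
    refine card_le_card_of_injOn tr ?_ (hinj.mono ?_)
    · intro x hx
      rw [mem_coe, mem_filter] at hx
      exact mem_coe.2 (mem_powersetCard.2 ⟨filter_subset _ _, hx.2⟩)
    · exact coe_subset.2 (filter_subset _ _)
  have h0 := hlevel 0
  have h1 := hlevel 1
  rw [Nat.choose_zero_right] at h0
  rw [Nat.choose_one_right] at h1
  have hedge : ∑ x ∈ Tᶜ, (tr x).card ≤ 2 * T.card := by
    simp only [tr, card_filter]
    rw [sum_comm, mul_comm, ← smul_eq_mul]
    refine sum_le_card_nsmul _ _ _ fun t _ => ?_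
    rw [← card_filter]
    exact (card_le_card (filter_subset_filter _ (subset_univ _))).trans (hdeg t)
  have hpoint : ∑ _x ∈ Tᶜ, 2 ≤ ∑ x ∈ Tᶜ, ((tr x).card +
      ((if (tr x).card = 1 then 1 else 0) + 2 * (if (tr x).card = 0 then 1 else 0))) := by
    refine sum_le_sum fun x _ => ?_
    split_ifs <;> omega
  rw [sum_add_distrib, sum_add_distrib, ← mul_sum, ← card_filter, ← card_filter, sum_const,
    smul_eq_mul] at hpoint
  have := card_add_card_compl T
  omega

/-! ### Paths and cycles -/

/-- Adjacency of the path `0, 1, …, n - 1`, closed up to a cycle when `c` holds. -/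
def RimAdj (c : Prop) (n i j : ℕ) : Prop :=
  i + 1 = j ∨ j + 1 = i ∨ (c ∧ (i = 0 ∧ j + 1 = n ∨ j = 0 ∧ i + 1 = n))

/-- The positions that resolve a path or cycle on `n` vertices: residues `1` and `3` modulo `5`,
except that `n - 2` is moved to `n - 3` when `n ≡ 3` modulo `5`. For `n ≥ 7`, read cyclically, at
most one gap between positions has three elements, none has more, and of two consecutive gaps one
is a single vertex. -/
def RimPos (n i : ℕ) : Prop :=
  (i % 5 = 1 ∨ i % 5 = 3) ∧ ¬(n % 5 = 3 ∧ i + 2 = n) ∨ n % 5 = 3 ∧ i + 3 = n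

theorem exists_rimPos_separating (c : Prop) {n x y : ℕ} (hn : 7 ≤ n) (hx : x < n) (hy : y < n)
    (hxy : x ≠ y) (hxS : ¬RimPos n x) (hyS : ¬RimPos n y) :
    ∃ s < n, RimPos n s ∧ ¬(RimAdj c n x s ↔ RimAdj c n y s) := by
  wlog hlt : x < y generalizing x y
  · obtain ⟨s, hs, hpos, hsep⟩ := this hy hx hxy.symm hyS hxS (by omega)
    exact ⟨s, hs, hpos, fun h => hsep h.symm⟩
  unfold RimPos at *
  -- Unless `5` divides `x`, the neighbour `x - 1` is a position, and it is not adjacent to `y > x`.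
  -- If `5` divides `x`, then `x + 1` is a position, to which of all `y > x` only `x + 2` can be
  -- adjacent; the position `x + 3` tells `x + 2` from `x`.
  by_cases h0 : x % 5 = 0
  · by_cases hy2 : y = x + 2
    · exact ⟨x + 3, by omega, by omega, fun h => absurd (h.2 (by unfold RimAdj; omega))
        (by rintro (h | h | ⟨-, h | h⟩) <;> omega)⟩
    · exact ⟨x + 1, by omega, by omega, fun h => absurd (h.1 (by unfold RimAdj; omega))
        (by rintro (h | h | ⟨-, h | h⟩) <;> omega)⟩
  · exact ⟨x - 1, by omega, by omega, fun h => absurd (h.1 (by unfold RimAdj; omega))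
      (by rintro (h | h | ⟨-, h | h⟩) <;> omega)⟩

theorem rimPos_card_le (n : ℕ) (S : Finset (Fin n)) (hS : ∀ i ∈ S, RimPos n i) :
    S.card ≤ 2 * (n + 1) / 5 := by
  -- Position `i` is sent to its rank among all positions.
  have := card_le_card_of_injOn (s := S) (t := range (2 * (n + 1) / 5))
    (fun i => (2 * i.val + 1) / 5) ?_ ?_
  · simpa using this
  · intro i hi
    have h := hS i hi
    have := i.isLt
    simp only [RimPos] at h
    simp only [coe_range, Set.mem_Iio]
    omega
  · intro i hi j hj hij
    have hi := hS i hi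
    have hj := hS j hj
    have := i.isLt
    have := j.isLt
    simp only [RimPos] at hi hj hij
    apply Fin.ext
    omega

theorem card_rimAdj_le (c : Prop) (n : ℕ) (x : Fin n) (S : Finset (Fin n))
    (hS : ∀ y ∈ S, RimAdj c n y x) : S.card ≤ 2 := by
  classical
  refine (card_le_card_of_injOn (t := {if x.val + 1 = n then 0 else x.val + 1,
    if x.val = 0 then n - 1 else x.val - 1}) Fin.val ?_ Fin.val_injective.injOn).trans card_le_two
  intro y hy
  have h := hS y hy
  have := y.isLt
  have := x.isLt
  simp only [RimAdj] at h
  simp only [coe_insert, coe_singleton, Set.mem_insert_iff, Set.mem_singleton_iff]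
  grind

/-! ### Wheels and fans as cones -/

/-- `H` is the cone with apex `z` over the path or cycle on `n` vertices, embedded by `f`. -/
structure IsCone {W : Type*} (H : SimpleGraph W) (c : Prop) (n : ℕ) (z : W) (f : Fin n → W) :
    Prop where
  injective : Function.Injective f
  ne : ∀ i, f i ≠ z
  cover : ∀ w, w = z ∨ ∃ i, w = f i
  adj_apex : ∀ i, H.Adj z (f i)
  adj_rim : ∀ i j, H.Adj (f i) (f j) ↔ RimAdj c n i j

theorem IsCone.card_eq {W : Type*} [Fintype W] {H : SimpleGraph W} {c : Prop} {n : ℕ} {z : W}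
    {f : Fin n → W} (h : IsCone H c n z f) : Fintype.card W = n + 1 := by
  have hbij : Function.Bijective (fun o : Option (Fin n) => o.elim z f) := by
    constructor
    · rintro (_ | i) (_ | j) hij
      · rfl
      · exact absurd hij.symm (h.ne j)
      · exact absurd hij (h.ne i)
      · exact congrArg some (h.injective hij)
    · intro w
      obtain rfl | ⟨i, rfl⟩ := h.cover w
      · exact ⟨none, rfl⟩
      · exact ⟨some i, rfl⟩
  rw [← Fintype.card_of_bijective hbij, Fintype.card_option, Fintype.card_fin]

theorem cycleGraph_adj_iff_rimAdj {n : ℕ} (hn : 3 ≤ n) (i j : Fin n) :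
    (SimpleGraph.cycleGraph n).Adj i j ↔ RimAdj True n i j := by
  have hi := i.isLt
  have hj := j.isLt
  rw [SimpleGraph.cycleGraph_adj']
  have hsub : ∀ a b : Fin n, (a - b).val = if b.val ≤ a.val then a.val - b.val
      else n + a.val - b.val := by
    intro a b
    have := a.isLt
    have := b.isLt
    rw [Fin.sub_def]
    split_ifs with h
    · change (n - b.val + a.val) % n = _
      rw [show n - b.val + a.val = a.val - b.val + n by omega, Nat.add_mod_right,
        Nat.mod_eq_of_lt (by omega)]
    · change (n - b.val + a.val) % n = _
      rw [Nat.mod_eq_of_lt (by omega)]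
      omega
  rw [hsub, hsub, RimAdj, true_and]
  split_ifs <;> omega

theorem IsWheel.exists_isCone {W : Type*} {H : SimpleGraph W} (hH : IsWheel H) :
    ∃ c n z f, IsCone H c n z f := by
  obtain ⟨n, hn, ⟨e⟩⟩ := hH
  refine ⟨True, n, e.symm (.inl 0), fun i => e.symm (.inr (0, i)), ?_, ?_, ?_, ?_, ?_⟩
  · intro i j hij
    simpa using e.symm.injective hij
  · intro i hi
    simpa using e.symm.injective hi
  · intro w
    rcases h : e w with a | ⟨a, i⟩
    · left
      rw [← Subsingleton.elim a 0, ← h, e.symm_apply_apply]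
    · right
      refine ⟨i, ?_⟩
      rw [← Subsingleton.elim a 0, ← h, e.symm_apply_apply]
  · intro i
    rw [e.symm.map_adj_iff]
    exact corona_adj_inl_inr 0 i
  · intro i j
    rw [e.symm.map_adj_iff, ← cycleGraph_adj_iff_rimAdj hn]
    exact and_iff_right rfl

theorem IsFan.exists_isCone {W : Type*} {H : SimpleGraph W} (hH : IsFan H) :
    ∃ c n z f, IsCone H c n z f := by
  obtain ⟨n, hn, ⟨e⟩⟩ := hH
  refine ⟨False, n, e.symm (.inl 0), fun i => e.symm (.inr i), ?_, ?_, ?_, ?_, ?_⟩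
  · intro i j hij
    simpa using e.symm.injective hij
  · intro i hi
    simpa using e.symm.injective hi
  · intro w
    rcases h : e w with a | i
    · left
      rw [← Subsingleton.elim a 0, ← h, e.symm_apply_apply]
    · right
      refine ⟨i, ?_⟩
      rw [← h, e.symm_apply_apply]
  · intro i
    rw [e.symm.map_adj_iff]
    simp [fanGraph, join]
  · intro i j
    rw [e.symm.map_adj_iff]
    simp [fanGraph, join, SimpleGraph.pathGraph_adj, RimAdj]

/-- The apex is adjacent to the whole rim, so it does not help to resolve the rim. -/
theorem IsCone.le_card {W : Type*} {H : SimpleGraph W} {c : Prop} {n : ℕ} {z : W}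
    {f : Fin n → W} (h : IsCone H c n z f) {S : Finset W} (hS : AdjResolving H S) :
    2 * (n + 1) / 5 ≤ S.card := by
  classical
  set T : Finset (Fin n) := univ.filter fun i => f i ∈ S with hTdef
  have hT : AdjResolving (H.comap f) T := by
    intro i j hij
    obtain ⟨s, hs, hsep⟩ := hS (f i) (f j) (h.injective.ne hij)
    obtain rfl | ⟨k, rfl⟩ := h.cover s
    · rcases hsep with hsep | hsep | hsep
      · exact absurd hsep (h.ne i)
      · exact absurd hsep (h.ne j)
      · exact absurd (iff_of_true (h.adj_apex i).symm (h.adj_apex j).symm) hsep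
    · refine ⟨k, by simpa [hTdef] using hs, ?_⟩
      rwa [h.injective.eq_iff, h.injective.eq_iff] at hsep
  have hcard : T.card ≤ S.card :=
    card_le_card_of_injOn f (fun i hi => by simpa [hTdef] using hi) h.injective.injOn
  have := hT.two_mul_card_le fun x => card_rimAdj_le c n x _ fun y hy => by
    simpa [h.adj_rim] using hy
  rw [Fintype.card_fin] at this
  omega

theorem IsCone.exists_adjResolving {W : Type*} {H : SimpleGraph W} {c : Prop} {n : ℕ} {z : W}
    {f : Fin n → W} (h : IsCone H c n z f) (hn : 7 ≤ n) :
    ∃ S : Finset W, AdjResolving H S ∧ S.card ≤ 2 * (n + 1) / 5 := by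
  classical
  refine ⟨(univ.filter fun i : Fin n => RimPos n i).image f, ?_,
    card_image_le.trans (rimPos_card_le n _ fun i hi => by simpa using hi)⟩
  have hmem : ∀ i : Fin n, RimPos n i → f i ∈ (univ.filter fun i : Fin n => RimPos n i).image f :=
    fun i hi => mem_image_of_mem f (by simpa using hi)
  -- Vertex `2` is the only common neighbour of `1` and `3`, and it has no other neighbour.
  have hapex : ∀ i : Fin n, ∃ s < n, RimPos n s ∧ ¬RimAdj c n i s := by
    intro i
    have hi := i.isLt
    obtain ⟨s, hsn, hs, h1, h2, h3⟩ : ∃ s < n, RimPos n s ∧ i.val + 1 ≠ s ∧ s + 1 ≠ i.val ∧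
        ¬(i.val = 0 ∧ s + 1 = n ∨ s = 0 ∧ i.val + 1 = n) := by
      unfold RimPos
      by_cases hi2 : i.val = 2
      · by_cases h8 : n = 8
        · exact ⟨5, by omega⟩
        · exact ⟨6, by omega⟩
      · by_cases hi0 : i.val = 0
        · exact ⟨3, by omega⟩
        · exact ⟨1, by omega⟩
    exact ⟨s, hsn, hs, by rintro (h | h | ⟨-, h⟩) <;> contradiction⟩
  intro x y hxy
  obtain rfl | ⟨i, rfl⟩ := h.cover x <;> obtain rfl | ⟨j, rfl⟩ := h.cover y
  · exact absurd rfl hxy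
  · obtain ⟨s, hsn, hs, hadj⟩ := hapex j
    refine ⟨f ⟨s, hsn⟩, hmem _ hs, .inr (.inr fun hiff => hadj ?_)⟩
    exact (h.adj_rim _ _).1 (hiff.1 (h.adj_apex _))
  · obtain ⟨s, hsn, hs, hadj⟩ := hapex i
    refine ⟨f ⟨s, hsn⟩, hmem _ hs, .inr (.inr fun hiff => hadj ?_)⟩
    exact (h.adj_rim _ _).1 (hiff.2 (h.adj_apex _))
  · by_cases hi : RimPos n i
    · exact ⟨f i, hmem i hi, .inl rfl⟩
    by_cases hj : RimPos n j
    · exact ⟨f j, hmem j hj, .inr (.inl rfl)⟩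
    obtain ⟨s, hsn, hs, hsep⟩ := exists_rimPos_separating c hn i.isLt j.isLt
      (fun hij => hxy (congrArg f (Fin.ext hij))) hi hj
    refine ⟨f ⟨s, hsn⟩, hmem _ hs, .inr (.inr ?_)⟩
    rwa [h.adj_rim, h.adj_rim]

end CoronaDim

theorem mainTheorem9 {V : Type u} {W : Type v} [Fintype V] [Fintype W]
    (G : SimpleGraph V) (H : SimpleGraph W) (hG : G.Connected)
    (n₁ n₂ k : ℕ) (hV : Fintype.card V = n₁) (hW : Fintype.card W = n₂)
    (hn₁ : 2 ≤ n₁) (hn₂ : 8 ≤ n₂) (hk : 1 ≤ k)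
    (hH : CoronaDim.IsWheel H ∨ CoronaDim.IsFan H) :
    CoronaDim.metricDim (CoronaDim.coronaPow G H k) =
      n₁ * (n₂ + 1) ^ (k - 1) * (2 * n₂ / 5) := by
  obtain ⟨k, rfl⟩ : ∃ j, k = j + 1 := ⟨k - 1, by omega⟩
  obtain ⟨c, n, z, f, hcone⟩ : ∃ c n z f, CoronaDim.IsCone H c n z f :=
    hH.elim (fun h => h.exists_isCone) (fun h => h.exists_isCone)
  have hn : n₂ = n + 1 := hW.symm.trans hcone.card_eq
  have := CoronaDim.finite_coronaPowVert (V := V) (W := W) k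
  have := Fintype.ofFinite (CoronaDim.CoronaPowVert V W k)
  have hcard : Fintype.card (CoronaDim.CoronaPowVert V W k) = n₁ * (n₂ + 1) ^ k := by
    rw [← Nat.card_eq_fintype_card, CoronaDim.card_coronaPowVert, Nat.card_eq_fintype_card,
      Nat.card_eq_fintype_card, hV, hW]
  have : Nontrivial (CoronaDim.CoronaPowVert V W k) := by
    rw [← Fintype.one_lt_card_iff_nontrivial, hcard]
    exact lt_of_lt_of_le hn₁ (Nat.le_mul_of_pos_right _ (by positivity))
  have : Nontrivial W := Fintype.one_lt_card_iff_nontrivial.1 (by omega)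
  rw [Nat.add_sub_cancel, ← hcard, hn]
  exact CoronaDim.metricDim_corona (CoronaDim.coronaPow_connected H hG k)
    (hcone.exists_adjResolving (by omega)) fun _ hT => hcone.le_card hT
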